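/- Let $X$ be a real separable Banach space with dual $X^*$ (carrying the norm topology) which is quasireflexive, i.e. the canonical image of $X$ in $X^{**}$ has finite codimension. Let $m\ge 2$ and $n$ be natural numbers, and let $A_{pi}$ ($p=1,\dots,m$, $i=1,\dots,n$) be bounded linear operators on $X$ with $\operatorname{Ker}A_{pi}=\{0\}$ for all $p,i$. Put $$G_i=\{(A_{1i}x,\dots,A_{mi}x)\in X^m : x\in X\},\qquad i=1,\dots,n,$$ and suppose that $\overline{G_i}\cap\overline{G_j}=\{0\}$ in $X^m$ whenever $i\ne j$. For an $X^k$-valued random vector $\boldsymbol\zeta=(\zeta_1,\dots,\zeta_k)$ write $\hat\mu_{\boldsymbol\zeta}(f_1,\dots,f_k)=\mathbb E\big[e^{\mathrm i(f_1(\zeta_1)+\dots+f_k(\zeta_k))}\big]$, $f_j\in X^*$, for its characteristic functional. Let $\xi_1,\dots,\xi_n$ be $X$-valued random variables on a common probability space such that: 1. $\xi_1,\dots,\xi_n$ are $Q$-independent: there is a continuous function $q:(X^*)^n\to\mathbb C$ with $q(0)=0$ that is a polynomial, in the sense that for some $N$ one has $\Delta_h^{N+1}q(f)=0$ for all $f,h\in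 (X^*)^n$, where $\Delta_hq(f)=q(f+h)-q(f)$, such that $$\hat\mu_{(\xi_1,\dots,\xi_n)}(f_1,\dots,f_n)=\Big(\prod_{j=1}^n\hat\mu_{\xi_j}(f_j)\Big)\exp\{q(f_1,\dots,f_n)\},\qquad f_1,\dots,f_n\in X^*;$$ 2. $\hat\mu_{\xi_i}(f)\neq 0$ for all $f\in X^*$ and all $i$. Put $L_p=A_{p1}\xi_1+\dots+A_{pn}\xi_n$ for $p=1,\dots,m$, and suppose that $\mathbf L=(L_1,\dots,L_m)$ belongs to the class $\mathcal D_{m,m-1}$, i.e. $$\hat\mu_{\mathbf L}(f_1,\dots,f_m)=\prod_{1\le i_1<\dots<i_{m-1}\le m}R_{i_1,\dots,i_{m-1}}(f_{i_1},\dots,f_{i_{m-1}}),\qquad f_1,\dots,f_m\in X^*,$$ for some continuous functions $R_{i_1,\dots,i_{m-1}}:(X^*)^{m-1}\to\mathbb C$ with $R_{i_1,\dots,i_{m-1}}(0,\dots,0)=1$. Then every $\xi_i$ is Gaussian: for each $f\in X^*$ the real random variable $f(\xi_i)$ has a (possibly degenerate) Gaussian distribution. -/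

import Mathlib

open MeasureTheory ProbabilityTheory

section

variable {X : Type*} [NormedAddCommGroup X] [NormedSpace ℝ X]

/-- A real normed space is quasireflexive if its canonical image in its second dual has finite
codimension. -/
def IsQuasireflexive (X : Type*) [NormedAddCommGroup X] [NormedSpace ℝ X] : Prop :=
  FiniteDimensional ℝ (StrongDual ℝ (StrongDual ℝ X) ⧸
    LinearMap.range (NormedSpace.inclusionInDoubleDual ℝ X).toLinearMap)

/-- A complex-valued function `ψ` on an additive group is a polynomial if for some `N` the iterated
finite differences `Δ_h ^ (N + 1) ψ` vanish identically for every step `h`, where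
`(Δ_h ψ) f = ψ (f + h) - ψ f`. -/
def IsDiffPolynomial {E : Type*} [AddCommGroup E] (ψ : E → ℂ) : Prop :=
  ∃ N : ℕ, ∀ f h : E, (fwdDiff h)^[N + 1] ψ f = 0

variable [MeasurableSpace X] {Ω : Type*} [MeasurableSpace Ω]

/-- The characteristic functional of the law on `X ^ k` of the random vector `(ζ 1, …, ζ k)`,
evaluated at the functional `(x 1, …, x k) ↦ ∑ i, f i (x i)`. -/
noncomputable def jointCharFunDual {k : ℕ} (P : Measure Ω) (ζ : Fin k → Ω → X)
    (f : Fin k → StrongDual ℝ X) : ℂ :=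
  charFunDual (P.map (fun ω i => ζ i ω)) (∑ i, (f i).comp (ContinuousLinearMap.proj i))

/-- `Q`-independence of the random variables `ξ 1, …, ξ n`: the joint characteristic functional is
the product of the marginal ones times `exp q`, for a continuous polynomial `q` with `q 0 = 0`. -/
def QIndepFun {n : ℕ} (P : Measure Ω) (ξ : Fin n → Ω → X) : Prop :=
  ∃ q : (Fin n → StrongDual ℝ X) → ℂ, Continuous q ∧ IsDiffPolynomial q ∧ q 0 = 0 ∧
    ∀ f : Fin n → StrongDual ℝ X,
      jointCharFunDual P ξ f = (∏ j, charFunDual (P.map (ξ j)) (f j)) * Complex.exp (q f)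

/-- The class `𝒟_{m,k}`: the joint characteristic functional of `(ζ 1, …, ζ m)` is a product, over
all `k`-element sets `s` of indices, of continuous functions `R s` of the variables `f i`, `i ∈ s`,
which take the value `1` at the origin. -/
def InClassD {m : ℕ} (k : ℕ) (P : Measure Ω) (ζ : Fin m → Ω → X) : Prop :=
  ∃ R : (s : Finset (Fin m)) → (s → StrongDual ℝ X) → ℂ,
    (∀ s : Finset (Fin m), s.card = k → Continuous (R s) ∧ R s 0 = 1) ∧
    ∀ f : Fin m → StrongDual ℝ X,
      jointCharFunDual P ζ f =
        ∏ s ∈ Finset.powersetCard k Finset.univ, R s (fun i => f i)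

end

open Filter Topology

/-! Let `B i f = ∑ p, f p ∘ A p i` be the adjoint of `x ↦ (A p i x)_p`. Comparing the two
expressions for the characteristic functional of `L` gives `∏ i, μ̂_i (B i f) * exp (q (B f)) = ∏ s,
R s f`. Read in the group of units of `ℂ`, written additively, this is a functional equation that
needs no choice of logarithm.

Finite differences isolate the `i`-th term. Each `R s` omits some variable `p`, so a step supported
on coordinate `p` kills it; a step in `Ker (B j)` kills `μ̂_j ∘ B j`; iterated differences kill the
polynomial `q`. What survives says that differences of `μ̂_i` vanish for steps in the images under
`B i` of these spaces of steps.

These images separate the points of `X`: by injectivity of `A p i` in the first case, by Hahn–Banach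
and `closure G_i ∩ closure G_j = {0}` in the second. A separating space of functionals need not be
norm dense, but an `L²` argument makes it dense for a.e. convergence
(`exists_seq_tendsto_ae_of_separating`), which characteristic functionals respect. Hence the
differences of `μ̂_i` vanish for every step (`fwdDiff_iter_eq_zero_of_functional_equation`).

On each line `μ̂_i` is then the exponential of a polynomial by Fréchet's theorem, and
Marcinkiewicz's theorem concludes. -/

/-- Iterated differences of size `h` are bounded by `‖h‖ ^ n` times the `n`-th derivative. -/
theorem norm_fwdDiff_iter_le_of_norm_iteratedDeriv_le (n : ℕ) {F : ℂ → ℂ} (hF : Differentiable ℂ F)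
    {ρ C : ℝ} (h : ℂ) (hC : ∀ z, ‖z‖ ≤ ρ + n * ‖h‖ → ‖iteratedDeriv n F z‖ ≤ C) {z : ℂ}
    (hz : ‖z‖ ≤ ρ) : ‖(fwdDiff h)^[n] F z‖ ≤ C * ‖h‖ ^ n := by
  induction n generalizing F C with
  | zero => simpa using hC z (by simpa using hz)
  | succ n ih =>
    have hF' : ContDiff ℂ (⊤ : ℕ∞) F := hF.contDiff
    have hsh : Differentiable ℂ fun z => F (z + h) := hF.comp (differentiable_id.add_const h)
    rw [Function.iterate_succ_apply, pow_succ', ← mul_assoc]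
    refine ih (F := fwdDiff h F) (hsh.sub hF) fun w hw => ?_
    have e : iteratedDeriv n (fwdDiff h F) w = iteratedDeriv n F (w + h) - iteratedDeriv n F w := by
      have : fwdDiff h F = (fun z => F (z + h)) - F := rfl
      rw [this, iteratedDeriv_sub (hsh.contDiff.contDiffAt) (hF.contDiff.contDiffAt),
        iteratedDeriv_comp_add_const]
    have hd : Differentiable ℂ (iteratedDeriv n F) :=
      (hF'.differentiable_iteratedDeriv n (by exact_mod_cast WithTop.coe_lt_top n))
    have hcl : ‖w + h‖ ≤ ρ + (n + 1 : ℕ) * ‖h‖ := by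
      push_cast
      linarith [norm_add_le w h]
    have hcl' : ‖w‖ ≤ ρ + (n + 1 : ℕ) * ‖h‖ := by
      push_cast
      linarith [norm_nonneg h]
    rw [e]
    have := (convex_closedBall (0 : ℂ) (ρ + (n + 1 : ℕ) * ‖h‖)).norm_image_sub_le_of_norm_deriv_le
      (f := iteratedDeriv n F) (C := C) (fun x _ => hd x)
      (fun x hx => by
        rw [← iteratedDeriv_succ]
        exact hC x (by simpa using hx)) (x := w) (y := w + h) (by simpa using hcl')
      (by simpa using hcl)
    simpa using this

/-! ### Entire characteristic functions and Marcinkiewicz's theorem. -/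

section Marcinkiewicz

variable {μ : Measure ℝ}

theorem charFun_fwdDiff_iter [IsFiniteMeasure μ] (n : ℕ) (h y : ℝ) :
    (fwdDiff h)^[n] (charFun μ) y =
      ∫ x, Complex.exp (y * x * Complex.I) * (Complex.exp (h * x * Complex.I) - 1) ^ n ∂μ := by
  induction n generalizing y with
  | zero => simp [charFun_apply_real]
  | succ n ih =>
    have hint : ∀ y : ℝ, Integrable (fun x : ℝ => Complex.exp (y * x * Complex.I) *
        (Complex.exp (h * x * Complex.I) - 1) ^ n) μ := fun y => by
      refine Integrable.of_bound (C := 2 ^ n) (by fun_prop) (ae_of_all _ fun x => ?_)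
      have h1 : ∀ a : ℝ, ‖Complex.exp (a * x * Complex.I)‖ = 1 := fun a => by
        rw [← Complex.ofReal_mul, Complex.norm_exp_ofReal_mul_I]
      rw [norm_mul, h1, one_mul, norm_pow]
      gcongr
      refine (norm_sub_le _ _).trans ?_
      rw [h1, norm_one]
      norm_num
    rw [Function.iterate_succ_apply', fwdDiff, ih, ih, ← integral_sub (hint _) (hint _)]
    congr 1 with x
    have : Complex.exp ((y + h : ℝ) * x * Complex.I) =
        Complex.exp (y * x * Complex.I) * Complex.exp (h * x * Complex.I) := by
      rw [← Complex.exp_add]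
      push_cast
      ring_nf
    rw [this]
    ring

/-- Since `e^{-iθ} (e^{iθ} - 1)² = 2 cos θ - 2`, starting the difference of order `2k` at `-kh`
makes the integrand nonnegative up to a global sign. Bounds on differences thus become bounds on
even moments. -/
theorem integral_two_sub_two_cos_pow [IsFiniteMeasure μ] (k : ℕ) (h : ℝ) :
    ∫ x, (2 - 2 * Real.cos (h * x)) ^ k ∂μ = ‖(fwdDiff h)^[2 * k] (charFun μ) (-(k * h))‖ := by
  rw [charFun_fwdDiff_iter]
  have e : ∀ x : ℝ, Complex.exp (((-(k * h) : ℝ) : ℂ) * x * Complex.I) *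
      (Complex.exp (h * x * Complex.I) - 1) ^ (2 * k) =
      (-1) ^ k * (((2 - 2 * Real.cos (h * x)) ^ k : ℝ) : ℂ) := fun x => by
    have h1 : Complex.exp (((-(k * h) : ℝ) : ℂ) * x * Complex.I) =
        Complex.exp (-(h * x * Complex.I)) ^ k := by
      rw [← Complex.exp_nat_mul]
      push_cast
      ring_nf
    rw [h1, pow_mul, ← mul_pow]
    push_cast
    rw [← mul_pow, Complex.cos]
    congr 1
    have h2 : Complex.exp (-(h * x * Complex.I)) * Complex.exp (h * x * Complex.I) = 1 := by
      rw [← Complex.exp_add]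
      simp
    rw [show -((h : ℂ) * x) * Complex.I = -(h * x * Complex.I) by ring]
    linear_combination (Complex.exp (h * x * Complex.I) - 2) * h2
  simp_rw [e]
  rw [integral_const_mul, integral_complex_ofReal, norm_mul, norm_pow, norm_neg, norm_one,
    one_pow, one_mul, Complex.norm_real, Real.norm_of_nonneg]
  exact integral_nonneg fun x => pow_nonneg (by linarith [Real.cos_le_one (h * x)]) _

theorem tendsto_two_sub_two_cos_div_sq (x : ℝ) {h : ℕ → ℝ} (hh : Tendsto h atTop (𝓝 0))
    (h0 : ∀ n, h n ≠ 0) :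
    Tendsto (fun n => (2 - 2 * Real.cos (h n * x)) / h n ^ 2) atTop (𝓝 (x ^ 2)) := by
  have e : ∀ n, (2 - 2 * Real.cos (h n * x)) / h n ^ 2 = (x * Real.sinc (h n * x / 2)) ^ 2 := by
    intro n
    have hc : Real.cos (h n * x) = 1 - 2 * Real.sin (h n * x / 2) ^ 2 := by
      have := Real.cos_sq' (h n * x / 2)
      have h2 := Real.cos_two_mul (h n * x / 2)
      rw [show 2 * (h n * x / 2) = h n * x by ring] at h2
      rw [h2, this]
      ring
    rcases eq_or_ne x 0 with rfl | hx
    · simp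
    · have := h0 n
      rw [Real.sinc_of_ne_zero (by positivity), hc]
      field_simp
      ring
  simp_rw [e]
  have h1 : Tendsto (fun n => h n * x / 2) atTop (𝓝 0) := by
    simpa using (hh.mul_const x).div_const 2
  have h2 := (Real.continuous_sinc.tendsto 0).comp h1
  rw [Real.sinc_zero] at h2
  simpa using (h2.const_mul x).pow 2

/-- If the characteristic function is the restriction of an entire function, the even moments are
bounded as in Cauchy's estimate. -/
theorem lintegral_pow_le_of_charFun_eq [IsFiniteMeasure μ] {G : ℂ → ℂ} (hG : Differentiable ℂ G)
    (h : ∀ t : ℝ, charFun μ t = G t) {R C : ℝ} (hR : 0 < R)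
    (hC : ∀ z, ‖z‖ ≤ 1 + R → ‖G z‖ ≤ C) (k : ℕ) :
    ∫⁻ x, ENNReal.ofReal (x ^ (2 * k)) ∂μ ≤
      ENNReal.ofReal ((2 * k).factorial * C / R ^ (2 * k)) := by
  set D : ℝ := (2 * k).factorial * C / R ^ (2 * k)
  have hD : ∀ z, ‖z‖ ≤ 1 → ‖iteratedDeriv (2 * k) G z‖ ≤ D := fun z hz =>
    Complex.norm_iteratedDeriv_le_of_forall_mem_sphere_norm_le _ hR
      hG.diffContOnCl fun w hw => hC w <| by
        have := norm_add_le (w - z) z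
        rw [sub_add_cancel, mem_sphere_iff_norm.1 hw] at this
        linarith
  -- A difference of order `2k` with step `s`, started within `k s` of the origin, stays within `3k
  -- s`; this size of `s n` keeps it in the unit disc, where `hD` applies.
  let s : ℕ → ℝ := fun n => 1 / ((3 * k + 1 : ℕ) * ((n : ℝ) + 1))
  have hs0 : ∀ n, 0 < s n := fun n => by positivity
  have hs : Tendsto s atTop (𝓝 0) := by
    have := (tendsto_one_div_add_atTop_nhds_zero_nat (𝕜 := ℝ)).const_mul (1 / ((3 * k + 1 : ℕ) : ℝ))
    rw [mul_zero] at this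
    refine this.congr fun n => ?_
    rw [one_div_mul_one_div]
  have hsk : ∀ n, (3 * k : ℝ) * s n ≤ 1 := fun n => by
    rw [mul_one_div]
    refine (div_le_one (by positivity)).2 ?_
    push_cast
    nlinarith [Nat.cast_nonneg (α := ℝ) n, Nat.cast_nonneg (α := ℝ) k]
  have hdiff : ∀ n, ‖(fwdDiff (s n))^[2 * k] (charFun μ) (-(k * s n))‖ ≤ D * s n ^ (2 * k) := by
    intro n
    have e : (fwdDiff (s n))^[2 * k] (charFun μ) (-(k * s n)) =
        (fwdDiff (s n : ℂ))^[2 * k] G ((-(k * s n) : ℝ) : ℂ) := by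
      rw [fwdDiff_iter_eq_sum_shift, fwdDiff_iter_eq_sum_shift]
      simp [h]
    rw [e]
    have := norm_fwdDiff_iter_le_of_norm_iteratedDeriv_le (2 * k) hG (ρ := k * s n) (C := D)
      (s n : ℂ) (fun z hz => hD z (hz.trans ?_)) (z := ((-(k * s n) : ℝ) : ℂ)) ?_
    · simpa [abs_of_pos (hs0 n)] using this
    · have := hsk n
      rw [Complex.norm_real, Real.norm_of_nonneg (hs0 n).le]
      push_cast
      linarith
    · rw [Complex.norm_real, norm_neg, Real.norm_of_nonneg]
      exact mul_nonneg (by positivity) (hs0 n).le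
  let φ : ℕ → ℝ → ℝ := fun n x => ((2 - 2 * Real.cos (s n * x)) / s n ^ 2) ^ k
  have hφ0 : ∀ n x, 0 ≤ φ n x := fun n x =>
    pow_nonneg (div_nonneg (by linarith [Real.cos_le_one (s n * x)]) (by positivity)) _
  have hφ : ∀ n, ∫⁻ x, ENNReal.ofReal (φ n x) ∂μ ≤ ENNReal.ofReal D := fun n => by
    have hb : Integrable (φ n) μ := by
      refine Integrable.of_bound (C := (4 / s n ^ 2) ^ k)
        (Continuous.aestronglyMeasurable (by fun_prop)) (ae_of_all _ fun x => ?_)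
      rw [Real.norm_of_nonneg (hφ0 n x)]
      have := hs0 n
      have := Real.cos_le_one (s n * x)
      have := Real.neg_one_le_cos (s n * x)
      refine pow_le_pow_left₀ (div_nonneg (by linarith) (by positivity)) ?_ _
      gcongr
      linarith
    rw [← ofReal_integral_eq_lintegral_ofReal hb (ae_of_all _ (hφ0 n))]
    apply ENNReal.ofReal_le_ofReal
    have := hs0 n
    simp only [φ, div_pow]
    rw [integral_div, integral_two_sub_two_cos_pow, div_le_iff₀ (by positivity), ← pow_mul]
    exact hdiff n
  have hlim : ∀ x : ℝ, ENNReal.ofReal (x ^ (2 * k)) =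
      liminf (fun n => ENNReal.ofReal (φ n x)) atTop := fun x => by
    refine (Tendsto.liminf_eq ?_).symm
    rw [pow_mul]
    exact ENNReal.tendsto_ofReal
      ((tendsto_two_sub_two_cos_div_sq x hs fun n => (hs0 n).ne').pow k)
  -- Fatou's lemma: no integrability of `x ^ (2 * k)` is presupposed.
  calc ∫⁻ x, ENNReal.ofReal (x ^ (2 * k)) ∂μ
      = ∫⁻ x, liminf (fun n => ENNReal.ofReal (φ n x)) atTop ∂μ := by simp_rw [← hlim]
    _ ≤ liminf (fun n => ∫⁻ x, ENNReal.ofReal (φ n x) ∂μ) atTop :=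
        lintegral_liminf_le fun n => (Continuous.measurable (by fun_prop)).ennreal_ofReal
    _ ≤ ENNReal.ofReal D := liminf_le_of_le (by isBoundedDefault) fun b hb => by
        obtain ⟨n, hn⟩ := hb.exists
        exact hn.trans (hφ n)

theorem integrableExpSet_eq_univ_of_charFun_eq [IsFiniteMeasure μ] {G : ℂ → ℂ}
    (hG : Differentiable ℂ G) (h : ∀ t : ℝ, charFun μ t = G t) :
    integrableExpSet id μ = Set.univ := by
  refine Set.eq_univ_of_forall fun r => ?_
  -- Any `R > |r|` would do: the Cauchy bounds then dominate the series of `∫ cosh (r x)` by a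
  -- geometric one of ratio `(|r| / R)²`.
  let R : ℝ := 2 * |r| + 1
  have hR : 0 < R := by positivity
  obtain ⟨C, hC⟩ := (isCompact_closedBall (0 : ℂ) (1 + R)).exists_bound_of_continuousOn
    hG.continuous.continuousOn
  have hC' : ∀ z, ‖z‖ ≤ 1 + R → ‖G z‖ ≤ C := fun z hz => hC z (by simpa using hz)
  have hC0 : 0 ≤ C := (norm_nonneg _).trans (hC' 0 (by simp; positivity))
  have hq : |r| / R < 1 := by
    rw [div_lt_one hR]
    simp only [R]
    linarith [abs_nonneg r]
  have hcosh : Integrable (fun x => Real.cosh (r * x)) μ := by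
    refine ⟨Continuous.aestronglyMeasurable (by fun_prop), ?_⟩
    rw [hasFiniteIntegral_iff_ofReal (ae_of_all _ fun x => (Real.cosh_pos _).le)]
    have e : ∀ x, ENNReal.ofReal (Real.cosh (r * x)) =
        ∑' k : ℕ, ENNReal.ofReal ((r * x) ^ (2 * k) / (2 * k).factorial) := fun x => by
      have hs := Real.hasSum_cosh (r * x)
      rw [← ENNReal.ofReal_tsum_of_nonneg
        (fun k => div_nonneg (by rw [pow_mul]; positivity) (by positivity)) hs.summable,
        hs.tsum_eq]
    simp_rw [e]
    rw [lintegral_tsum fun k => (Continuous.measurable (by fun_prop)).ennreal_ofReal.aemeasurable]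
    have hle : ∀ k : ℕ, ∫⁻ x, ENNReal.ofReal ((r * x) ^ (2 * k) / (2 * k).factorial) ∂μ ≤
        ENNReal.ofReal (C * ((|r| / R) ^ 2) ^ k) := fun k => by
      have e2 : ∀ x : ℝ, ENNReal.ofReal ((r * x) ^ (2 * k) / (2 * k).factorial) =
          ENNReal.ofReal (r ^ (2 * k) / (2 * k).factorial) * ENNReal.ofReal (x ^ (2 * k)) :=
        fun x => by
          rw [← ENNReal.ofReal_mul (div_nonneg (by rw [pow_mul]; positivity) (by positivity))]
          congr 1
          ring
      simp_rw [e2]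
      rw [lintegral_const_mul _ (by fun_prop)]
      refine (mul_le_mul_right (lintegral_pow_le_of_charFun_eq hG h hR hC' k) _).trans ?_
      rw [← ENNReal.ofReal_mul (div_nonneg (by rw [pow_mul]; positivity) (by positivity))]
      apply ENNReal.ofReal_le_ofReal
      have : ((2 * k).factorial : ℝ) ≠ 0 := by positivity
      rw [div_pow, sq_abs, div_pow, ← pow_mul, ← pow_mul]
      apply le_of_eq
      field_simp
    refine (ENNReal.tsum_le_tsum hle).trans_lt ?_
    have hsum : Summable fun k : ℕ => C * ((|r| / R) ^ 2) ^ k :=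
      (summable_geometric_of_lt_one (by positivity)
        (pow_lt_one₀ (by positivity) hq two_ne_zero)).mul_left C
    rw [← ENNReal.ofReal_tsum_of_nonneg (fun k => by positivity) hsum]
    exact ENNReal.ofReal_lt_top
  refine (hcosh.const_mul 2).mono' (Continuous.aestronglyMeasurable (by fun_prop))
    (ae_of_all _ fun x => ?_)
  rw [Real.norm_of_nonneg (Real.exp_pos _).le, Real.cosh_eq]
  simp only [id]
  linarith [Real.exp_pos (-(r * x))]

/-- The ridge property of an entire characteristic function. -/
theorem norm_le_norm_im_of_charFun_eq [IsProbabilityMeasure μ] {G : ℂ → ℂ}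
    (hG : Differentiable ℂ G) (h : ∀ t : ℝ, charFun μ t = G t) (z : ℂ) :
    ‖G z‖ ≤ ‖G (z.im * Complex.I)‖ := by
  have hu := integrableExpSet_eq_univ_of_charFun_eq hG h
  have hM : Differentiable ℂ (complexMGF id μ) := fun w =>
    (analyticAt_complexMGF (by simp [hu])).differentiableAt
  have hM' : Differentiable ℂ fun w => complexMGF id μ (w * Complex.I) :=
    hM.comp (differentiable_id.mul_const _)
  have key : (fun w => complexMGF id μ (w * Complex.I)) = G := by
    refine AnalyticOnNhd.eq_of_frequently_eq (z₀ := 0)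
      (fun w _ => hM'.analyticAt w) (fun w _ => hG.analyticAt w) ?_
    have ht : Tendsto (fun n : ℕ => ((1 / ((n : ℝ) + 1) : ℝ) : ℂ)) atTop (𝓝[≠] 0) := by
      refine tendsto_nhdsWithin_iff.2 ⟨?_, Eventually.of_forall fun n => ?_⟩
      · simpa [Function.comp_def] using (Complex.continuous_ofReal.tendsto 0).comp
          (tendsto_one_div_add_atTop_nhds_zero_nat (𝕜 := ℝ))
      · simp only [Set.mem_compl_iff, Set.mem_singleton_iff, Complex.ofReal_eq_zero]
        positivity
    refine ht.frequently (Frequently.of_forall fun n => ?_)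
    rw [complexMGF_id_mul_I, h]
  have e1 : G z = complexMGF id μ (z * Complex.I) := by rw [← key]
  have e2 : G (z.im * Complex.I) = complexMGF id μ ((-z.im : ℝ) : ℂ) := by
    have : ((-z.im : ℝ) : ℂ) = z.im * Complex.I * Complex.I := by
      rw [mul_assoc, Complex.I_mul_I]
      simp
    rw [← key, this]
  rw [e1, e2, complexMGF_ofReal, Complex.norm_real]
  refine norm_complexMGF_le_mgf.trans ?_
  simp [abs_of_nonneg (mgf_nonneg)]

theorem Polynomial.tendsto_eval_mul_div_pow (p : Polynomial ℂ) (u : ℂ) :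
    Tendsto (fun r : ℝ => p.eval (r * u) / (r : ℂ) ^ p.natDegree) atTop
      (𝓝 (p.leadingCoeff * u ^ p.natDegree)) := by
  have e : ∀ᶠ r : ℝ in atTop, ∑ j ∈ Finset.range (p.natDegree + 1),
      p.coeff j * u ^ j * (((r⁻¹ : ℝ) : ℂ) ^ (p.natDegree - j)) =
      p.eval (r * u) / (r : ℂ) ^ p.natDegree := by
    filter_upwards [eventually_gt_atTop 0] with r hr
    rw [Polynomial.eval_eq_sum_range, Finset.sum_div]
    refine Finset.sum_congr rfl fun j hj => ?_
    have hr' : (r : ℂ) ≠ 0 := by exact_mod_cast hr.ne'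
    have hj' : j ≤ p.natDegree := Nat.lt_succ_iff.1 (Finset.mem_range.1 hj)
    rw [eq_div_iff (pow_ne_zero _ hr'), ← Nat.sub_add_cancel hj', pow_add]
    simp only [Nat.add_sub_cancel]
    push_cast
    rw [inv_pow, mul_pow]
    field_simp
  refine Tendsto.congr' e ?_
  have hi : Tendsto (fun r : ℝ => ((r⁻¹ : ℝ) : ℂ)) atTop (𝓝 0) := by
    simpa [Function.comp_def] using (Complex.continuous_ofReal.tendsto 0).comp tendsto_inv_atTop_zero
  have hsum : p.leadingCoeff * u ^ p.natDegree = ∑ j ∈ Finset.range (p.natDegree + 1),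
      p.coeff j * u ^ j * (0 : ℂ) ^ (p.natDegree - j) := by
    rw [Finset.sum_range_succ, Finset.sum_eq_zero]
    · simp
    · intro j hj
      rw [zero_pow (Nat.sub_ne_zero_of_lt (Finset.mem_range.1 hj)), mul_zero]
  rw [hsum]
  exact tendsto_finsetSum _ fun j _ => (hi.pow _).const_mul _

/-- A polynomial whose real part is dominated by its values on the imaginary axis has degree at
most two. -/
theorem Polynomial.natDegree_le_two_of_re_le_re_im (p : Polynomial ℂ)
    (hp : ∀ z : ℂ, (p.eval z).re ≤ (p.eval (z.im * Complex.I)).re) : p.natDegree ≤ 2 := by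
  by_contra! hd
  set d := p.natDegree with hd_def
  set a := p.leadingCoeff with ha_def
  have hd0 : d ≠ 0 := by omega
  have ha : a ≠ 0 := by
    rw [ha_def, Ne, Polynomial.leadingCoeff_eq_zero]
    rintro rfl
    simp at hd_def
    omega
  -- The leading terms along the ray `r * u`, `r → ∞`, inherit the inequality.
  have key : ∀ u : ℂ, (a * u ^ d).re ≤ (a * (u.im * Complex.I) ^ d).re := fun u => by
    refine le_of_tendsto_of_tendsto
      ((Complex.continuous_re.tendsto _).comp (p.tendsto_eval_mul_div_pow u))
      ((Complex.continuous_re.tendsto _).comp (p.tendsto_eval_mul_div_pow (u.im * Complex.I))) ?_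
    filter_upwards [eventually_gt_atTop 0] with r hr
    have := hp (r * u)
    simp only [Function.comp_apply, ← Complex.ofReal_pow, Complex.div_ofReal_re]
    refine div_le_div_of_nonneg_right ?_ (by positivity)
    simpa [mul_assoc] using this
  -- A root of `a u^d = ‖a‖` has modulus one and makes the left side of `key` maximal, which forces
  -- `|Im u| = 1`, so `u = ± i`.
  have root : ∀ u : ℂ, a * u ^ d = ‖a‖ → u ^ 2 = -1 := fun u hu => by
    have ha' : 0 < ‖a‖ := norm_pos_iff.2 ha
    have hn : ‖u‖ = 1 := by
      have : ‖a‖ * ‖u‖ ^ d = ‖a‖ := by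
        rw [← norm_pow, ← norm_mul, hu]
        simp
      have : ‖u‖ ^ d = 1 := by
        field_simp at this
        exact this
      exact (pow_eq_one_iff_of_nonneg (norm_nonneg _) hd0).1 this
    have h1 := (key u).trans (Complex.re_le_norm _)
    rw [hu, Complex.ofReal_re, norm_mul, norm_pow, norm_mul, Complex.norm_I, mul_one,
      Complex.norm_real, Real.norm_eq_abs] at h1
    have h2 : 1 ≤ |u.im| ^ d := by
      by_contra! hlt
      nlinarith
    have h3 : 1 ≤ |u.im| := by
      by_contra! hlt
      exact absurd (pow_lt_one₀ (abs_nonneg _) hlt hd0) (not_lt.2 h2)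
    have h4 : u.re * u.re + u.im * u.im = 1 := by
      rw [← Complex.normSq_apply, Complex.normSq_eq_norm_sq, hn, one_pow]
    have h5 : 1 ≤ u.im ^ 2 := by
      rw [← sq_abs]
      nlinarith
    have h6 : u.re = 0 := by nlinarith
    have h7 : u.im ^ 2 = 1 := by nlinarith
    apply Complex.ext
    · simp [sq, h6]
      nlinarith
    · simp [sq, h6]
  obtain ⟨u, hu⟩ := IsAlgClosed.exists_pow_nat_eq ((‖a‖ : ℂ) / a) (Nat.pos_of_ne_zero hd0)
  -- Roots are permuted by `ω` and all have square `-1`, so `ω² = 1` and `d ∣ 2`.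
  have hω := Complex.isPrimitiveRoot_exp d hd0
  set ω := Complex.exp (2 * Real.pi * Complex.I / d)
  have h1 := root u (by rw [hu]; field_simp)
  have h2 := root (u * ω) (by rw [mul_pow, hω.pow_eq_one, mul_one, hu]; field_simp)
  rw [mul_pow, h1, neg_one_mul, neg_inj] at h2
  have := Nat.le_of_dvd two_pos (hω.dvd_of_pow_eq_one 2 h2)
  omega

/-- **Marcinkiewicz's theorem**: a probability measure whose characteristic function is the
exponential of a polynomial is Gaussian. -/
theorem exists_eq_gaussianReal_of_charFun_eq_exp_polynomial [IsProbabilityMeasure μ]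
    (p : Polynomial ℂ) (hp : ∀ t : ℝ, charFun μ t = Complex.exp (p.eval (t : ℂ))) :
    ∃ m v, μ = gaussianReal m v := by
  have hG : Differentiable ℂ fun z => Complex.exp (p.eval z) := p.differentiable.cexp
  have hdeg : p.natDegree ≤ 2 := p.natDegree_le_two_of_re_le_re_im fun z => by
    have := norm_le_norm_im_of_charFun_eq hG hp z
    rwa [Complex.norm_exp, Complex.norm_exp, Real.exp_le_exp] at this
  set b := p.coeff 1
  set c := p.coeff 2
  have hexp : ∀ t : ℝ, charFun μ t = Complex.exp (b * t + c * t ^ 2) := fun t => by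
    have he : ∀ z, p.eval z = p.coeff 0 + b * z + c * z ^ 2 := fun z => by
      rw [Polynomial.eval_eq_sum_range' (Nat.lt_succ_of_le hdeg)]
      simp [Finset.sum_range_succ, b, c]
    have h0 : Complex.exp (p.coeff 0) = 1 := by
      have := hp 0
      rw [charFun_zero, he] at this
      simpa using this.symm
    rw [hp, he, add_assoc, Complex.exp_add, h0, one_mul]
  have hre : ∀ t : ℝ, b.re * t + c.re * t ^ 2 ≤ 0 := fun t => by
    have := norm_charFun_le_one (μ := μ) t
    rw [hexp, Complex.norm_exp, Real.exp_le_one_iff] at this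
    simpa [← Complex.ofReal_pow] using this
  have hc : c.re ≤ 0 := by linarith [hre 1, hre (-1)]
  have hb : b.re = 0 := by
    by_contra hb
    have := hre (b.re / (1 - c.re))
    have h1 : 0 < 1 - c.re := by linarith
    have h2 : b.re * (b.re / (1 - c.re)) + c.re * (b.re / (1 - c.re)) ^ 2 =
        (b.re / (1 - c.re)) ^ 2 := by
      field_simp
      ring
    rw [h2] at this
    have : 0 < (b.re / (1 - c.re)) ^ 2 := by positivity
    linarith
  have hb' : (starRingEnd ℂ) b = -b := by
    apply Complex.ext <;> simp [hb]
  have him : c.im = 0 := by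
    have hone : ∀ t : ℝ, Complex.exp ((2 * (c.im * t ^ 2) : ℝ) * Complex.I) = 1 := fun t => by
      have h1 := charFun_neg (μ := μ) t
      rw [hexp, hexp, ← Complex.exp_conj] at h1
      have h2 : (c.im : ℂ) * 2 * Complex.I = c - (starRingEnd ℂ) c := by
        rw [Complex.sub_conj]
        push_cast
        ring
      have h3 : ((2 * (c.im * t ^ 2) : ℝ) : ℂ) * Complex.I = (b * (-t : ℝ) + c * (-t : ℝ) ^ 2) -
          (starRingEnd ℂ) (b * t + c * t ^ 2) := by
        simp only [map_add, map_mul, map_pow, Complex.conj_ofReal, hb']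
        push_cast
        linear_combination (t : ℂ) ^ 2 * h2
      rw [h3, Complex.exp_sub, h1, div_self (Complex.exp_ne_zero _)]
    -- Small enough that `|c.im * t ^ 2| < 1 < π`, which leaves only the period `k = 0`.
    let t : ℝ := Real.sqrt (1 / (|c.im| + 1))
    have ht : t ^ 2 = 1 / (|c.im| + 1) := Real.sq_sqrt (by positivity)
    obtain ⟨k, hk⟩ := Complex.exp_eq_one_iff.1 (hone t)
    have hk' : 2 * (c.im * t ^ 2) = k * (2 * Real.pi) := by
      have := congrArg Complex.im hk
      simpa [← Complex.ofReal_pow] using this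
    have hsmall : |c.im * t ^ 2| < 1 := by
      rw [ht, abs_mul, abs_of_nonneg (by positivity : (0 : ℝ) ≤ 1 / (|c.im| + 1)), mul_one_div,
        div_lt_one (by positivity)]
      linarith
    have hk0 : k = 0 := by
      by_contra hk0
      have h1 : (1 : ℝ) ≤ |(k : ℝ)| := by exact_mod_cast Int.one_le_abs hk0
      have h2 : |c.im * t ^ 2| = |(k : ℝ)| * Real.pi := by
        rw [show c.im * t ^ 2 = k * Real.pi by linarith, abs_mul, abs_of_pos Real.pi_pos]
      nlinarith [Real.pi_gt_three]
    rw [hk0, ht] at hk'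
    have : |c.im| + 1 ≠ 0 := by positivity
    simpa [this] using hk'
  refine ⟨b.im, (-2 * c.re).toNNReal, Measure.ext_of_charFun ?_⟩
  ext t
  have h1 : b = b.im * Complex.I := by apply Complex.ext <;> simp [hb]
  have h2 : c = c.re := by apply Complex.ext <;> simp [him]
  rw [hexp, charFun_gaussianReal, Real.coe_toNNReal _ (by linarith), h1, h2]
  push_cast
  simp
  ring_nf

end Marcinkiewicz

/-! ### Fréchet's theorem, additive and multiplicative. -/

theorem AddMonoidHom.fwdDiff_iter_comp {M G H : Type*} [AddCommMonoid M] [AddCommGroup G]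
    [AddCommGroup H] (φ : G →+ H) (f : M → G) (h : M) (n : ℕ) :
    (fwdDiff h)^[n] (φ ∘ f) = φ ∘ (fwdDiff h)^[n] f := by
  induction n generalizing f with
  | zero => rfl
  | succ n ih =>
    rw [Function.iterate_succ_apply, Function.iterate_succ_apply, ← ih]
    congr 1
    ext x
    simp [fwdDiff]

theorem fwdDiff_iter_comp_addMonoidHom {M N G : Type*} [AddCommMonoid M] [AddCommMonoid N]
    [AddCommGroup G] (B : M →+ N) (f : N → G) (h : M) (n : ℕ) :
    (fwdDiff h)^[n] (f ∘ B) = (fwdDiff (B h))^[n] f ∘ B := by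
  induction n generalizing f with
  | zero => rfl
  | succ n ih =>
    rw [Function.iterate_succ_apply, Function.iterate_succ_apply, ← ih]
    congr 1
    ext x
    simp [fwdDiff]

/-- The exponential as a homomorphism into the units of `ℂ`. -/
noncomputable def expUnitsHom : ℂ →+ Additive ℂˣ where
  toFun z := Additive.ofMul (Units.mk0 (Complex.exp z) (Complex.exp_ne_zero z))
  map_zero' := by
    rw [← ofMul_one]
    congr 1
    ext
    simp
  map_add' x y := by
    rw [← ofMul_mul]
    congr 1
    ext
    simp [Complex.exp_add]

theorem expUnitsHom_eq_zero_iff {z : ℂ} : expUnitsHom z = 0 ↔ Complex.exp z = 1 := by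
  change Additive.ofMul (Units.mk0 (Complex.exp z) (Complex.exp_ne_zero z)) = Additive.ofMul 1 ↔ _
  rw [Additive.ofMul.apply_eq_iff_eq, Units.ext_iff]
  rfl

theorem exists_polynomial_eval_eq_sum_choose {N : ℕ} (c : ℕ → ℂ) :
    ∃ p : Polynomial ℂ, ∀ k : ℕ, p.eval (k : ℂ) = ∑ j ∈ Finset.range N, k.choose j • c j := by
  refine ⟨∑ j ∈ Finset.range N, Polynomial.C (c j / j.factorial) * descPochhammer ℂ j,
    fun k => ?_⟩
  rw [Polynomial.eval_finsetSum]
  refine Finset.sum_congr rfl fun j _ => ?_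
  have : (j.factorial : ℂ) ≠ 0 := by exact_mod_cast j.factorial_ne_zero
  rw [Polynomial.eval_mul, Polynomial.eval_C, descPochhammer_eval_eq_descFactorial,
    Nat.descFactorial_eq_factorial_mul_choose, nsmul_eq_mul]
  push_cast
  field_simp

/-- Newton's forward difference formula, whose terms of order at least `N` vanish. -/
theorem exists_polynomial_on_lattice {θ : ℝ → ℂ} {N : ℕ}
    (hθ : ∀ h t : ℝ, (fwdDiff h)^[N] θ t = 0) (a : ℝ) {h : ℝ} (hh : h ≠ 0) :
    ∃ p : Polynomial ℂ, ∀ k : ℕ, θ (a + k * h) = p.eval ((k * h : ℝ) : ℂ) := by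
  obtain ⟨p, hp⟩ := exists_polynomial_eval_eq_sum_choose (N := N)
    fun j => (fwdDiff h)^[j] θ a
  have hvan : ∀ j, N ≤ j → (fwdDiff h)^[j] θ a = 0 := fun j hj => by
    obtain ⟨i, rfl⟩ := Nat.exists_eq_add_of_le' hj
    rw [Function.iterate_add_apply, show (fwdDiff h)^[N] θ = fun _ => 0 from funext (hθ h)]
    exact congrFun (Function.iterate_fixed (by ext; simp [fwdDiff]) i) a
  refine ⟨p.comp (Polynomial.C ((h : ℂ)⁻¹) * Polynomial.X), fun k => ?_⟩
  have hk := shift_eq_sum_fwdDiff_iter h θ k a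
  rw [nsmul_eq_mul] at hk
  have h0 : (h : ℂ) ≠ 0 := by exact_mod_cast hh
  rw [hk, Polynomial.eval_comp, Polynomial.eval_mul, Polynomial.eval_C, Polynomial.eval_X]
  push_cast
  rw [show (h : ℂ)⁻¹ * (k * h) = k by field_simp, hp]
  rcases le_total (k + 1) N with hN | hN
  · refine Finset.sum_subset (Finset.range_mono hN) fun j _ hj => ?_
    rw [Nat.choose_eq_zero_of_lt (by simpa using hj), zero_smul]
  · refine (Finset.sum_subset (Finset.range_mono hN) fun j _ hj => ?_).symm
    rw [hvan j (by simpa using hj), smul_zero]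

theorem Polynomial.eq_of_forall_natCast_eval_eq {p q : Polynomial ℂ}
    (h : ∀ k : ℕ, p.eval (k : ℂ) = q.eval (k : ℂ)) : p = q :=
  Polynomial.eq_of_infinite_eval_eq p q <|
    (Set.infinite_range_of_injective (Nat.cast_injective (R := ℂ))).mono <| by
      rintro _ ⟨k, rfl⟩
      exact h k

/-- The polynomials found on the lattices of step `1 / (M + 1)` all agree on the integers, hence
coincide; continuity passes from rationals to reals. -/
theorem exists_polynomial_on_Ici {θ : ℝ → ℂ} (hc : Continuous θ) {N : ℕ}
    (hθ : ∀ h t : ℝ, (fwdDiff h)^[N] θ t = 0) (a : ℝ) :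
    ∃ p : Polynomial ℂ, ∀ t : ℝ, 0 ≤ t → θ (a + t) = p.eval (t : ℂ) := by
  obtain ⟨p, hp⟩ := exists_polynomial_on_lattice hθ a one_ne_zero
  refine ⟨p, fun t ht => ?_⟩
  have hrat : ∀ k M : ℕ, θ (a + k / ((M : ℝ) + 1)) = p.eval ((k / ((M : ℝ) + 1) : ℝ) : ℂ) := by
    intro k M
    have hM : ((M : ℝ) + 1)⁻¹ ≠ 0 := by positivity
    obtain ⟨q, hq⟩ := exists_polynomial_on_lattice hθ a hM
    have : q = p := Polynomial.eq_of_forall_natCast_eval_eq fun l => by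
      have h1 := hp l
      have h2 := hq (l * (M + 1))
      have e : ((l * (M + 1) : ℕ) : ℝ) * ((M : ℝ) + 1)⁻¹ = l := by
        push_cast
        field_simp
      rw [e] at h2
      rw [mul_one] at h1
      simpa using h2.symm.trans h1
    rw [div_eq_mul_inv, hq, this]
  have hfl : Tendsto (fun M : ℕ => (⌊t * ((M : ℝ) + 1)⌋₊ : ℝ) / ((M : ℝ) + 1)) atTop (𝓝 t) :=
    (tendsto_nat_floor_mul_div_atTop ht).comp
      (tendsto_atTop_add_const_right _ 1 tendsto_natCast_atTop_atTop)
  have h1 := ((hc.comp (continuous_const_add a)).tendsto t).comp hfl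
  have h2 := ((p.continuous.comp Complex.continuous_ofReal).tendsto t).comp hfl
  refine tendsto_nhds_unique h1 (h2.congr fun M => ?_)
  simp only [Function.comp_apply]
  rw [hrat]

/-- **Fréchet's theorem**: a continuous function on `ℝ` annihilated by iterated differences is a
polynomial. -/
theorem exists_polynomial_of_fwdDiff_iter_eq_zero {θ : ℝ → ℂ} (hc : Continuous θ) {N : ℕ}
    (hθ : ∀ h t : ℝ, (fwdDiff h)^[N] θ t = 0) :
    ∃ p : Polynomial ℂ, ∀ t : ℝ, θ t = p.eval (t : ℂ) := by
  obtain ⟨p, hp⟩ := exists_polynomial_on_Ici hc hθ 0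
  refine ⟨p, fun t => ?_⟩
  -- The half-line from `-|t|` contains both `t` and the naturals, where the shifted `q` is compared
  -- with `p`.
  obtain ⟨q, hq⟩ := exists_polynomial_on_Ici hc hθ (-|t|)
  have e : q.comp (Polynomial.X + Polynomial.C ((|t| : ℝ) : ℂ)) = p :=
    Polynomial.eq_of_forall_natCast_eval_eq fun k => by
      have h1 := hp k (Nat.cast_nonneg k)
      have h2 := hq (k + |t|) (by positivity)
      rw [show -|t| + ((k : ℝ) + |t|) = 0 + k by ring, h1] at h2
      simpa using h2.symm
  have h2 := hq (t + |t|) (by linarith [neg_abs_le t])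
  rw [show -|t| + (t + |t|) = t by ring] at h2
  rw [h2, ← e]
  simp

theorem exists_continuous_log {γ : ℝ → ℂ} (hc : Continuous γ) (h0 : ∀ t, γ t ≠ 0) :
    ∃ θ : ℝ → ℂ, Continuous θ ∧ ∀ t, Complex.exp (θ t) = γ t := by
  let f : C(ℝ, {z : ℂ // z ≠ 0}) := ⟨fun t => ⟨γ t, h0 t⟩, by fun_prop⟩
  obtain ⟨F, ⟨-, hF⟩, -⟩ := Complex.isCoveringMap_exp.existsUnique_continuousMap_lifts f 0
    (Complex.log (γ 0)) (Subtype.ext (Complex.exp_log (h0 0)))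
  exact ⟨F, F.continuous, fun t => congrArg Subtype.val (congrFun hF t)⟩

theorem eq_zero_of_forall_exp_eq_one {D : ℝ → ℂ} (hc : Continuous D)
    (h1 : ∀ t, Complex.exp (D t) = 1) (h0 : D 0 = 0) (t : ℝ) : D t = 0 := by
  refine congrFun (Complex.isCoveringMap_exp.eq_of_comp_eq hc (continuous_const (y := (0 : ℂ)))
    (funext fun s => Subtype.ext ?_) 0 h0) t
  simp [h1]

/-- A nowhere vanishing continuous function, annihilated by iterated multiplicative differences, is
the exponential of a polynomial. -/
theorem exists_polynomial_exp_of_fwdDiff_iter_eq_zero {γ : ℝ → ℂ} (hc : Continuous γ)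
    (h0 : ∀ t, γ t ≠ 0) {N : ℕ}
    (hγ : ∀ h t : ℝ, (fwdDiff h)^[N] (fun t => Additive.ofMul (Units.mk0 (γ t) (h0 t))) t = 0) :
    ∃ p : Polynomial ℂ, ∀ t : ℝ, γ t = Complex.exp (p.eval (t : ℂ)) := by
  obtain ⟨θ, hθ, hexp⟩ := exists_continuous_log hc h0
  have e : (fun t => Additive.ofMul (Units.mk0 (γ t) (h0 t))) = expUnitsHom ∘ θ := by
    ext t
    exact (hexp t).symm
  -- Differences of `θ` are only known to lie in `2πiℤ`; continuity in `h` and vanishing at `h = 0`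
  -- make them zero. The order `N + 1` ensures the latter even when `N = 0`.
  have hN : ∀ h t : ℝ, (fwdDiff h)^[N + 1] θ t = 0 := fun h t => by
    refine eq_zero_of_forall_exp_eq_one (D := fun h => (fwdDiff h)^[N + 1] θ t) ?_ (fun h => ?_)
      ?_ h
    · simp_rw [fwdDiff_iter_eq_sum_shift]
      fun_prop
    · rw [← expUnitsHom_eq_zero_iff]
      have := congrFun (expUnitsHom.fwdDiff_iter_comp θ h (N + 1)) t
      rw [Function.comp_apply] at this
      rw [← this, ← e, Function.iterate_succ_apply', fwdDiff, hγ, hγ, sub_zero]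
    · rw [Function.iterate_succ_apply']
      simp [fwdDiff]
  obtain ⟨p, hp⟩ := exists_polynomial_of_fwdDiff_iter_eq_zero hθ hN
  exact ⟨p, fun t => by rw [← hexp, hp]⟩

/-! ### Isolating one term of the functional equation. -/

section Annihilated

variable {E F M : Type*} [AddCommGroup E] [AddCommGroup F] [AddCommGroup M]

/-- `g` vanishes after taking successive differences with steps from the given sets. -/
def AnnihilatedBy : List (Set E) → (E → M) → Prop
  | [], g => ∀ x, g x = 0
  | S :: Ss, g => ∀ h ∈ S, AnnihilatedBy Ss (fwdDiff h g)

theorem fwdDiff_comm (h k : E) (g : E → M) :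
    fwdDiff h (fwdDiff k g) = fwdDiff k (fwdDiff h g) := by
  ext x
  simp only [fwdDiff]
  rw [add_right_comm]
  abel

theorem fwdDiff_iter_zero (h : E) (n : ℕ) : (fwdDiff h)^[n] (0 : E → M) = 0 :=
  Function.iterate_fixed (by ext; simp [fwdDiff]) n

namespace AnnihilatedBy

theorem zero (Ss : List (Set E)) : AnnihilatedBy Ss (0 : E → M) := by
  induction Ss with
  | nil => exact fun _ => rfl
  | cons S Ss ih =>
    intro h _
    have : fwdDiff h (0 : E → M) = 0 := fwdDiff_iter_zero h 1
    rwa [this]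

theorem add {Ss : List (Set E)} {f g : E → M} (hf : AnnihilatedBy Ss f)
    (hg : AnnihilatedBy Ss g) : AnnihilatedBy Ss (f + g) := by
  induction Ss generalizing f g with
  | nil => exact fun x => by rw [Pi.add_apply, hf x, hg x, add_zero]
  | cons S Ss ih =>
    intro h hh
    rw [fwdDiff_add]
    exact ih (hf h hh) (hg h hh)

theorem neg {Ss : List (Set E)} {f : E → M} (hf : AnnihilatedBy Ss f) :
    AnnihilatedBy Ss (-f) := by
  induction Ss generalizing f with
  | nil => exact fun x => by rw [Pi.neg_apply, hf x, neg_zero]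
  | cons S Ss ih =>
    intro h hh
    have : fwdDiff h (-f) = -fwdDiff h f := by
      ext x
      simp only [fwdDiff, Pi.neg_apply]
      abel
    rw [this]
    exact ih (hf h hh)

theorem sum {ι : Type*} {Ss : List (Set E)} (s : Finset ι) {f : ι → E → M}
    (hf : ∀ i ∈ s, AnnihilatedBy Ss (f i)) : AnnihilatedBy Ss (∑ i ∈ s, f i) :=
  Finset.sum_induction _ _ (fun _ _ => add) (zero Ss) hf

theorem fwdDiff {Ss : List (Set E)} {f : E → M} (hf : AnnihilatedBy Ss f) (h : E) :
    AnnihilatedBy Ss (fwdDiff h f) := by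
  induction Ss generalizing f with
  | nil => exact fun x => by rw [_root_.fwdDiff, hf, hf, sub_zero]
  | cons S Ss ih =>
    intro k hk
    rw [fwdDiff_comm]
    exact ih (hf k hk)

theorem fwdDiff_iter {Ss : List (Set E)} {f : E → M} (hf : AnnihilatedBy Ss f) (h : E) (n : ℕ) :
    AnnihilatedBy Ss ((_root_.fwdDiff h)^[n] f) := by
  induction n with
  | zero => exact hf
  | succ n ih =>
    rw [Function.iterate_succ_apply']
    exact ih.fwdDiff h

/-- Differences commute, so the place of `S` in the list is immaterial. -/
theorem of_mem {Ss : List (Set E)} {S : Set E} (hS : S ∈ Ss) {f : E → M}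
    (hf : ∀ h ∈ S, _root_.fwdDiff h f = 0) : AnnihilatedBy Ss f := by
  induction Ss generalizing f with
  | nil => simp at hS
  | cons T Ss ih =>
    intro h hh
    rcases List.mem_cons.1 hS with rfl | hS
    · rw [hf h hh]
      exact zero Ss
    · refine ih hS fun k hk => ?_
      rw [fwdDiff_comm, hf k hk]
      exact fwdDiff_iter_zero h 1

theorem fwdDiff_iter_eq_zero {α : Type*} {Ss : List α} {f : E → M}
    (hf : AnnihilatedBy (Ss.map fun _ => Set.univ) f) (h x : E) :
    (_root_.fwdDiff h)^[Ss.length] f x = 0 := by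
  induction Ss generalizing f with
  | nil => exact hf x
  | cons S Ss ih => exact ih (hf h (Set.mem_univ h))

theorem of_tendsto [TopologicalSpace M] [IsTopologicalAddGroup M] [T2Space M]
    {Ss : List (Set E)} {v : ℕ → E → M} {f : E → M} (hv : ∀ n, AnnihilatedBy Ss (v n))
    (h : ∀ x, Tendsto (fun n => v n x) atTop (𝓝 (f x))) : AnnihilatedBy Ss f := by
  induction Ss generalizing v f with
  | nil =>
    refine fun x => tendsto_nhds_unique (h x) ?_
    simp_rw [hv _ x]
    exact tendsto_const_nhds
  | cons S Ss ih => exact fun k hk => ih (fun n => hv n k hk) fun x => (h (x + k)).sub (h x)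

end AnnihilatedBy

/-- Every step can be approximated by steps from `S`, as far as the values of all translates of
`u` can tell. -/
def ApproximableBy [TopologicalSpace M] (u : F → M) (S : Set F) : Prop :=
  ∀ k, ∃ s : ℕ → F, (∀ n, s n ∈ S) ∧
    ∀ (x : F) (j : ℕ), Tendsto (fun n => u (x + j • s n)) atTop (𝓝 (u (x + j • k)))

variable [TopologicalSpace M] [IsTopologicalAddGroup M]

theorem ApproximableBy.fwdDiff {u : F → M} {S : Set F} (hu : ApproximableBy u S) (h : F) :
    ApproximableBy (fwdDiff h u) S := fun k => by
  obtain ⟨s, hs, hlim⟩ := hu k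
  refine ⟨s, hs, fun x j => ?_⟩
  have := (hlim (x + h) j).sub (hlim x j)
  simp only [add_right_comm x h] at this
  exact this

theorem ApproximableBy.fwdDiff_iter {u : F → M} {S : Set F} (hu : ApproximableBy u S) (h : F)
    (n : ℕ) : ApproximableBy ((_root_.fwdDiff h)^[n] u) S := by
  induction n with
  | zero => exact hu
  | succ n ih =>
    rw [Function.iterate_succ_apply']
    exact ih.fwdDiff h

theorem tendsto_fwdDiff_iter {u : F → M} {s : ℕ → F} {k : F}
    (hs : ∀ (x : F) (j : ℕ), Tendsto (fun n => u (x + j • s n)) atTop (𝓝 (u (x + j • k))))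
    (N : ℕ) (x : F) :
    Tendsto (fun n => (fwdDiff (s n))^[N] u x) atTop (𝓝 ((fwdDiff k)^[N] u x)) := by
  simp_rw [fwdDiff_iter_eq_sum_shift]
  exact tendsto_finsetSum _ fun j _ => ((continuous_zsmul _).tendsto _).comp (hs x j)

/-- Steps in `B '' S` are replaced one set at a time by arbitrary limits; the induction runs because
differences of `u` remain approximable. -/
theorem AnnihilatedBy.of_comp [T2Space M] {B : E →+ F} {Ss : List (Set E)} {u : F → M}
    (hB : ApproximableBy u (Set.range B)) (hS : ∀ S ∈ Ss, ApproximableBy u (B '' S))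
    (hu : AnnihilatedBy Ss (u ∘ B)) : AnnihilatedBy (Ss.map fun _ => Set.univ) u := by
  induction Ss generalizing u with
  | nil =>
    intro k
    obtain ⟨s, hs, hlim⟩ := hB k
    refine tendsto_nhds_unique (f := fun n => u (s n)) (by simpa using hlim 0 1) ?_
    have : ∀ n, u (s n) = 0 := fun n => by
      obtain ⟨e, he⟩ := hs n
      rw [← he]
      exact hu e
    simp_rw [this]
    exact tendsto_const_nhds
  | cons S Ss ih =>
    intro k _
    obtain ⟨s, hs, hlim⟩ := hS S List.mem_cons_self k
    refine AnnihilatedBy.of_tendsto (v := fun n => _root_.fwdDiff (s n) u) (fun n => ?_)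
      fun x => tendsto_fwdDiff_iter hlim 1 x
    obtain ⟨e, he, hes⟩ := hs n
    refine ih (hB.fwdDiff _) (fun T hT => (hS T (List.mem_cons_of_mem _ hT)).fwdDiff _) ?_
    rw [← hes]
    have := hu e he
    rwa [show _root_.fwdDiff e (u ∘ B) = _root_.fwdDiff (B e) u ∘ B from
      fwdDiff_iter_comp_addMonoidHom B u e 1] at this

/-- The functional equation `∑ i, u i (B i x) + w x = ∑ s, r s x` forces `u i` to be a polynomial,
provided that suitable differences annihilate all terms but `u i ∘ B i`. -/
theorem fwdDiff_iter_eq_zero_of_functional_equation [T2Space M] {ι σ : Type*} [Fintype ι]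
    (T : Finset σ) {B : ι → E →+ F} {u : ι → F → M} {w : E → M} {r : σ → E → M}
    (heq : ∀ x, ∑ i, u i (B i x) + w x = ∑ s ∈ T, r s x) {N : ℕ}
    (hw : ∀ h x, (fwdDiff h)^[N] w x = 0) (i : ι) {Ss : List (Set E)}
    (hr : ∀ s ∈ T, ∃ S ∈ Ss, ∀ h ∈ S, fwdDiff h (r s) = 0)
    (hker : ∀ j, j ≠ i → ∃ S ∈ Ss, ∀ h ∈ S, B j h = 0)
    (hB : ApproximableBy (u i) (Set.range (B i)))
    (hS : ∀ S ∈ Ss, ApproximableBy (u i) (B i '' S)) (k x : F) :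
    (fwdDiff k)^[Ss.length + N] (u i) x = 0 := by
  classical
  -- The `N` equal steps `h` remove `w`; each remaining term is removed by its own set in `Ss`.
  have hann : ∀ h : E,
      AnnihilatedBy (Ss.map fun _ => Set.univ) ((fwdDiff (B i h))^[N] (u i)) := fun h => by
    refine AnnihilatedBy.of_comp (hB.fwdDiff_iter _ _) (fun S hSs => (hS S hSs).fwdDiff_iter _ _) ?_
    rw [← fwdDiff_iter_comp_addMonoidHom]
    have e : u i ∘ B i = ∑ s ∈ T, r s + -∑ j ∈ Finset.univ.erase i, u j ∘ B j + -w := by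
      ext y
      have h1 := heq y
      rw [← Finset.add_sum_erase _ _ (Finset.mem_univ i)] at h1
      simp only [Function.comp_apply, Pi.add_apply, Pi.neg_apply, Finset.sum_apply]
      rw [← h1]
      abel
    have hw' : (fwdDiff h)^[N] (-w) = 0 := by
      ext y
      rw [show -w = (-1 : ℤ) • w by simp, fwdDiff_iter_const_smul, Pi.smul_apply, hw, smul_zero,
        Pi.zero_apply]
    rw [e, fwdDiff_iter_add, hw', add_zero]
    refine AnnihilatedBy.fwdDiff_iter (.add (.sum _ fun s hs => ?_)
      (.neg (.sum _ fun j hj => ?_))) h N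
    · obtain ⟨S, hSs, hS0⟩ := hr s hs
      exact .of_mem hSs hS0
    · obtain ⟨S, hSs, hS0⟩ := hker j (Finset.ne_of_mem_erase hj)
      refine .of_mem hSs fun h hh => ?_
      ext y
      simp [fwdDiff, hS0 h hh]
  have hdiag : ∀ h x, (fwdDiff (B i h))^[Ss.length + N] (u i) x = 0 := fun h x => by
    rw [Function.iterate_add_apply]
    exact (hann h).fwdDiff_iter_eq_zero _ x
  obtain ⟨s, hs, hlim⟩ := hB k
  refine tendsto_nhds_unique (tendsto_fwdDiff_iter hlim _ x) ?_
  have : ∀ n, (fwdDiff (s n))^[Ss.length + N] (u i) x = 0 := fun n => by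
    obtain ⟨e, he⟩ := hs n
    rw [← he]
    exact hdiag e x
  simp_rw [this]
  exact tendsto_const_nhds

end Annihilated

/-! ### Almost everywhere approximation of functionals; the Gaussian criterion. -/

section Approximation

variable {X : Type*} [NormedAddCommGroup X] [NormedSpace ℝ X] [MeasurableSpace X] [BorelSpace X] {μ : Measure X}
  [IsFiniteMeasure μ]

/-- A space of functionals separating the points of a Banach space is dense in the dual, for
almost everywhere convergence. -/
theorem exists_seq_tendsto_ae_of_separating [CompleteSpace X] [SecondCountableTopology X]
    (K : Submodule ℝ (StrongDual ℝ X))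
    (hK : ∀ x, (∀ k ∈ K, k x = 0) → x = 0) (f : StrongDual ℝ X) :
    ∃ s : ℕ → StrongDual ℝ X, (∀ n, s n ∈ K) ∧
      ∀ᵐ x ∂μ, Tendsto (fun n => s n x) atTop (𝓝 (f x)) := by
  -- The weight makes `x ↦ g (ρ x • x)` bounded, so `X*` maps into `L²(μ)` without moment
  -- assumptions.
  let ρ : X → ℝ := fun x => (1 + ‖x‖)⁻¹
  have hρ : ∀ x, 0 < ρ x := fun x => by positivity
  have hρc : Continuous ρ := by
    refine Continuous.inv₀ (by fun_prop) fun x => by positivity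
  have hρn : ∀ x, ‖ρ x • x‖ ≤ 1 := fun x => by
    rw [norm_smul, Real.norm_of_nonneg (hρ x).le, ← div_eq_inv_mul, div_le_one (by positivity)]
    linarith
  have hmem : ∀ g : StrongDual ℝ X, MemLp (fun x => g (ρ x • x)) 2 μ := fun g =>
    MemLp.of_bound (Continuous.aestronglyMeasurable (by fun_prop)) ‖g‖ <| ae_of_all _ fun x =>
      (g.le_opNorm _).trans (mul_le_of_le_one_right (norm_nonneg _) (hρn x))
  let T : StrongDual ℝ X →ₗ[ℝ] Lp ℝ 2 μ :=
    { toFun := fun g => (hmem g).toLp _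
      map_add' := fun g h => by
        rw [← MemLp.toLp_add]
        rfl
      map_smul' := fun c g => by
        rw [RingHom.id_apply, ← MemLp.toLp_const_smul]
        rfl }
  have hT : ∀ g, T g =ᵐ[μ] fun x => g (ρ x • x) := fun g => (hmem g).coeFn_toLp
  -- If `g` is orthogonal to `T K`, the Bochner integral of `g x • ρ x • x` is a vector of `X`
  -- killed by `K`, hence zero, so `g` is orthogonal to `T f` too.
  have hcl : T f ∈ (K.map T).topologicalClosure := by
    rw [← Submodule.orthogonal_orthogonal_eq_closure, Submodule.mem_orthogonal]
    intro g hg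
    have hint : Integrable (fun x => g x • (ρ x • x)) μ := by
      refine ((Lp.memLp g).integrable (by norm_num)).norm.mono'
        ((Lp.aestronglyMeasurable g).smul (Continuous.aestronglyMeasurable (by fun_prop)))
        (ae_of_all _ fun x => ?_)
      rw [norm_smul]
      exact mul_le_of_le_one_right (norm_nonneg _) (hρn x)
    have hinner : ∀ h : StrongDual ℝ X,
        inner ℝ g (T h) = h (∫ x, g x • (ρ x • x) ∂μ) := fun h => by
      rw [L2.inner_def, ← h.integral_comp_comm hint]
      refine integral_congr_ae ?_
      filter_upwards [hT h] with x hx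
      rw [hx, map_smul]
      simp [mul_comm]
    have h0 : ∫ x, g x • (ρ x • x) ∂μ = 0 := hK _ fun k hk => by
      rw [← hinner]
      exact Submodule.inner_left_of_mem_orthogonal (Submodule.mem_map_of_mem hk) hg
    rw [hinner, h0, map_zero]
  obtain ⟨y, hy, hlim⟩ := mem_closure_iff_seq_limit.1 hcl
  choose s hsK hsy using hy
  obtain ⟨ns, -, hns⟩ := (tendstoInMeasure_of_tendsto_Lp hlim).exists_seq_tendsto_ae
  refine ⟨fun n => s (ns n), fun n => hsK _, ?_⟩
  filter_upwards [hns, hT f, ae_all_iff.2 fun n => hT (s (ns n))] with x h1 h2 h3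
  have h4 : ∀ g : StrongDual ℝ X, g x = (ρ x)⁻¹ * g (ρ x • x) := fun g => by
    rw [map_smul, smul_eq_mul, inv_mul_cancel_left₀ (hρ x).ne']
  simp_rw [h4 f, h4 (s _), ← h2, ← h3, hsy]
  exact h1.const_mul _

theorem tendsto_charFunDual_of_ae {s : ℕ → StrongDual ℝ X} {f : StrongDual ℝ X}
    (h : ∀ᵐ x ∂μ, Tendsto (fun n => s n x) atTop (𝓝 (f x))) :
    Tendsto (fun n => charFunDual μ (s n)) atTop (𝓝 (charFunDual μ f)) := by
  simp_rw [charFunDual_apply]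
  refine tendsto_integral_of_dominated_convergence (fun _ => 1)
    (fun n => Continuous.aestronglyMeasurable (by fun_prop)) (integrable_const 1)
    (fun n => ae_of_all _ fun x => by rw [Complex.norm_exp_ofReal_mul_I]) ?_
  filter_upwards [h] with x hx
  exact ((Complex.continuous_exp.comp (Complex.continuous_ofReal.mul continuous_const)).tendsto
    _).comp hx

/-- A nowhere vanishing characteristic functional, as a map into the units of `ℂ`. -/
noncomputable def charFunDualUnits (μ : Measure X) (h : ∀ f, charFunDual μ f ≠ 0)
    (f : StrongDual ℝ X) : Additive ℂˣ :=
  Additive.ofMul (Units.mk0 (charFunDual μ f) (h f))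

theorem approximableBy_charFunDualUnits [CompleteSpace X] [SecondCountableTopology X]
    (h : ∀ f, charFunDual μ f ≠ 0)
    {S : Set (StrongDual ℝ X)} (K : Submodule ℝ (StrongDual ℝ X)) (hKS : (K : Set _) ⊆ S)
    (hK : ∀ x, (∀ k ∈ K, k x = 0) → x = 0) : ApproximableBy (charFunDualUnits μ h) S := by
  intro k
  obtain ⟨s, hsK, hs⟩ := exists_seq_tendsto_ae_of_separating (μ := μ) K hK k
  refine ⟨s, fun n => hKS (hsK n), fun x j => ?_⟩
  refine (continuous_ofMul.tendsto _).comp (Units.isEmbedding_val₀.tendsto_nhds_iff.2 ?_)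
  refine tendsto_charFunDual_of_ae ?_
  filter_upwards [hs] with y hy
  simpa using (hy.const_mul (j : ℝ)).const_add (x y)

/-- A measure on a Banach space whose nowhere vanishing characteristic functional is annihilated by
iterated multiplicative differences is Gaussian. -/
theorem isGaussian_of_fwdDiff_iter_charFunDualUnits_eq_zero {μ : Measure X}
    [IsProbabilityMeasure μ] (h : ∀ f, charFunDual μ f ≠ 0) {N : ℕ}
    (hN : ∀ k f, (fwdDiff k)^[N] (charFunDualUnits μ h) f = 0) : IsGaussian μ := by
  refine isGaussian_of_map_eq_gaussianReal fun L => ?_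
  have : IsProbabilityMeasure (μ.map L) :=
    Measure.isProbabilityMeasure_map L.continuous.aemeasurable
  have e : ∀ t, charFun (μ.map L) t = charFunDual μ (t • L) := charFun_map_eq_charFunDual_smul L
  have h0 : ∀ t, charFun (μ.map L) t ≠ 0 := fun t => e t ▸ h _
  obtain ⟨p, hp⟩ := exists_polynomial_exp_of_fwdDiff_iter_eq_zero (continuous_charFun) h0 (N := N)
    fun s t => by
      let B : ℝ →+ StrongDual ℝ X := (LinearMap.toSpanSingleton ℝ _ L).toAddMonoidHom
      have e1 : (fun t => Additive.ofMul (Units.mk0 (charFun (μ.map L) t) (h0 t))) =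
          charFunDualUnits μ h ∘ B := by
        ext t
        exact e t
      rw [e1, fwdDiff_iter_comp_addMonoidHom]
      exact hN _ _
  exact exists_eq_gaussianReal_of_charFun_eq_exp_polynomial p hp

end Approximation

/-! ### Adjoints and the closures of the graphs. -/

section Operators

variable {X : Type*} [NormedAddCommGroup X] [NormedSpace ℝ X] {m : ℕ}

/-- The adjoint of `x ↦ (A 1 x, …, A m x)`. -/
noncomputable def adjointTuple (A : Fin m → X →L[ℝ] X) :
    (Fin m → StrongDual ℝ X) →ₗ[ℝ] StrongDual ℝ X where
  toFun f := ∑ p, (f p).comp (A p)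
  map_add' f g := by
    ext x
    simp [Finset.sum_add_distrib]
  map_smul' c f := by
    ext x
    simp [Finset.mul_sum]

theorem adjointTuple_apply (A : Fin m → X →L[ℝ] X) (f : Fin m → StrongDual ℝ X) (x : X) :
    adjointTuple A f x = ∑ p, f p (A p x) := by
  simp [adjointTuple]

theorem adjointTuple_single (A : Fin m → X →L[ℝ] X) (p : Fin m) (h : StrongDual ℝ X) :
    adjointTuple A (Pi.single p h) = h.comp (A p) := by
  ext x
  rw [adjointTuple_apply, Finset.sum_eq_single p]
  · simp
  · intro q _ hq
    simp [Pi.single_eq_of_ne hq]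
  · simp

/-- Hahn–Banach: a functional vanishing on the range is a tuple in the kernel of the adjoint, and
such functionals detect the closure. -/
theorem mem_closure_range_of_forall_adjointTuple_eq_zero (A : Fin m → X →L[ℝ] X) (y : Fin m → X)
    (hy : ∀ f, adjointTuple A f = 0 → ∑ p, f p (y p) = 0) :
    y ∈ closure (Set.range fun (x : X) (p : Fin m) => A p x) := by
  let G : Submodule ℝ (Fin m → X) := LinearMap.range (LinearMap.pi fun p => (A p).toLinearMap)
  have hG : (Set.range fun (x : X) (p : Fin m) => A p x) = (G : Set (Fin m → X)) := rfl
  rw [hG, ← Submodule.topologicalClosure_coe]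
  by_contra hyG
  obtain ⟨φ, a, hya, ha⟩ := geometric_hahn_banach_point_closed G.topologicalClosure.convex
    G.isClosed_topologicalClosure hyG
  have ha0 : a < 0 := by simpa using ha 0 (zero_mem _)
  have hφ : ∀ b ∈ G, φ b = 0 := fun b hb => by
    by_contra h0
    have := ha ((a / φ b) • b) (G.topologicalClosure.smul_mem _ (G.le_topologicalClosure hb))
    rw [map_smul, smul_eq_mul, div_mul_cancel₀ _ h0] at this
    exact lt_irrefl _ this
  have hsum : ∀ z : Fin m → X,
      ∑ p, (φ.comp (ContinuousLinearMap.single ℝ (fun _ => X) p)) (z p) = φ z := fun z => by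
    simp only [ContinuousLinearMap.comp_apply, ContinuousLinearMap.single_apply]
    rw [← map_sum, Finset.univ_sum_single]
  have h0 := hy (fun p => φ.comp (ContinuousLinearMap.single ℝ (fun _ => X) p)) <| by
    ext x
    rw [adjointTuple_apply, hsum fun p => A p x]
    exact hφ _ ⟨x, rfl⟩
  rw [hsum] at h0
  linarith

end Operators

/-! ### The main theorem. -/

theorem theorem2p3 {X : Type*} [NormedAddCommGroup X] [NormedSpace ℝ X] [CompleteSpace X]
    [TopologicalSpace.SeparableSpace X] [MeasurableSpace X] [BorelSpace X]
    (hX : IsQuasireflexive X)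
    {Ω : Type*} [MeasurableSpace Ω] (P : Measure Ω) [IsProbabilityMeasure P]
    (m n : ℕ) (hm : 2 ≤ m)
    (A : Fin m → Fin n → X →L[ℝ] X)
    (hker : ∀ (p : Fin m) (i : Fin n), LinearMap.ker (A p i).toLinearMap = ⊥)
    (hG : ∀ i j : Fin n, i ≠ j →
      closure (Set.range fun (x : X) (p : Fin m) => A p i x) ∩
        closure (Set.range fun (x : X) (p : Fin m) => A p j x) = {0})
    (ξ : Fin n → Ω → X) (hξ : ∀ i, Measurable (ξ i))
    (hQ : QIndepFun P ξ)
    (hnv : ∀ (i : Fin n) (f : StrongDual ℝ X), charFunDual (P.map (ξ i)) f ≠ 0)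
    (hL : InClassD (m - 1) P (fun (p : Fin m) ω => ∑ i, A p i (ξ i ω))) :
    ∀ i, IsGaussian (P.map (ξ i)) := by
  have : SecondCountableTopology X := UniformSpace.secondCountable_of_separable X
  have hprob : ∀ i, IsProbabilityMeasure (P.map (ξ i)) := fun i =>
    Measure.isProbabilityMeasure_map (hξ i).aemeasurable
  obtain ⟨q, -, ⟨N, hN⟩, -, hq⟩ := hQ
  obtain ⟨R, -, hR⟩ := hL
  let B : Fin n → (Fin m → StrongDual ℝ X) →ₗ[ℝ] StrongDual ℝ X := fun i =>
    adjointTuple fun p => A p i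
  let BB : (Fin m → StrongDual ℝ X) →+ (Fin n → StrongDual ℝ X) :=
    AddMonoidHom.mk' (fun f i => B i f) fun f g => by
      ext1 i
      exact map_add (B i) f g
  have hjoint : ∀ {k : ℕ} (ζ : Fin k → Ω → X), (∀ i, Measurable (ζ i)) →
      ∀ f, jointCharFunDual P ζ f = ∫ ω, Complex.exp ((∑ i, f i (ζ i ω) : ℝ) * Complex.I) ∂P := by
    intro k ζ hζ f
    rw [jointCharFunDual, charFunDual_apply, integral_map (measurable_pi_lambda _ hζ).aemeasurable
      (Continuous.aestronglyMeasurable (by fun_prop))]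
    simp
  have heq : ∀ f : Fin m → StrongDual ℝ X,
      (∏ i, charFunDual (P.map (ξ i)) (B i f)) * Complex.exp (q (BB f)) =
        ∏ s ∈ Finset.powersetCard (m - 1) Finset.univ, R s (fun p => f p) := fun f => by
    rw [← hR, hjoint _ (fun p => by fun_prop)]
    refine (hq (BB f)).symm.trans ?_
    rw [hjoint _ hξ]
    congr 1 with ω
    simp only [BB, B, AddMonoidHom.mk'_apply, adjointTuple_apply, map_sum]
    rw [Finset.sum_comm]
  have hR0 : ∀ s ∈ Finset.powersetCard (m - 1) (Finset.univ : Finset (Fin m)),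
      ∀ f : Fin m → StrongDual ℝ X, R s (fun p => f p) ≠ 0 := fun s hs f h0 => by
    have h1 := heq f
    rw [Finset.prod_eq_zero hs h0] at h1
    exact mul_ne_zero (Finset.prod_ne_zero_iff.2 fun i _ => hnv i _) (Complex.exp_ne_zero _) h1
  have hT2 : T2Space (Additive ℂˣ) := inferInstanceAs (T2Space ℂˣ)
  intro i
  -- Coordinate axes are the steps against the `R s`; the kernels of `B j`, `j ≠ i`, are those
  -- against the other `ξ j`.
  let Ss : List (Set (Fin m → StrongDual ℝ X)) :=
    (List.finRange m).map (fun p => Set.range (Pi.single p)) ++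
      ((List.finRange n).filter (· ≠ i)).map fun j => (LinearMap.ker (B j) : Set _)
  have hAinj : ∀ p x, A p i x = 0 → x = 0 := fun p x hx =>
    LinearMap.ker_eq_bot'.1 (hker p i) x hx
  have hsep : ∀ p x, (∀ k ∈ LinearMap.range (B i ∘ₗ LinearMap.single ℝ _ p), k x = 0) → x = 0 := by
    intro p x hx
    refine hAinj p x (SeparatingDual.eq_zero_of_forall_dual_eq_zero (R := ℝ) fun h => ?_)
    have := hx _ ⟨h, rfl⟩
    rw [LinearMap.comp_apply, LinearMap.single_apply, adjointTuple_single] at this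
    exact this
  -- If `x` is killed by `B i (Ker (B j))`, then `(A p i x)_p` lies in `closure G_j` as well as in
  -- `G_i`, so it is zero.
  have hsep' : ∀ j, j ≠ i → ∀ x, (∀ k ∈ (LinearMap.ker (B j)).map (B i), k x = 0) → x = 0 := by
    intro j hj x hx
    have h1 := mem_closure_range_of_forall_adjointTuple_eq_zero (fun p => A p j)
      (fun p => A p i x) fun f hf => by
        rw [← adjointTuple_apply (fun p => A p i)]
        exact hx _ (Submodule.mem_map_of_mem hf)
    have h2 : (fun p => A p i x) ∈ ({0} : Set (Fin m → X)) := by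
      rw [← hG j i hj]
      exact ⟨h1, subset_closure ⟨x, rfl⟩⟩
    exact hAinj ⟨0, by omega⟩ x (congrFun h2 _)
  -- The default `0` is never used for sets of size `m - 1`, by `hR0`.
  let r : (s : Finset (Fin m)) → (s → StrongDual ℝ X) → Additive ℂˣ := fun s f =>
    if h : R s f ≠ 0 then Additive.ofMul (Units.mk0 _ h) else 0
  refine isGaussian_of_fwdDiff_iter_charFunDualUnits_eq_zero (hnv i) (N := Ss.length + (N + 1))
    fun k f => fwdDiff_iter_eq_zero_of_functional_equation
      (Finset.powersetCard (m - 1) (Finset.univ : Finset (Fin m))) (B := fun i => (B i).toAddMonoidHom)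
      (u := fun i => charFunDualUnits _ (hnv i)) (w := expUnitsHom ∘ (q ∘ BB)) (r := fun s f => r s fun p => f p)
      (fun f => ?_) (fun h f => ?_) i (fun s hs => ?_) (fun j hj => ?_) ?_ (fun S hS => ?_) k f
  · apply Additive.toMul.injective
    rw [toMul_add, toMul_sum, toMul_sum]
    ext
    rw [Units.val_mul, Units.coe_prod, Units.coe_prod]
    refine (heq f).trans (Finset.prod_congr rfl fun s hs => ?_)
    simp [r, hR0 s hs f]
  · rw [AddMonoidHom.fwdDiff_iter_comp, fwdDiff_iter_comp_addMonoidHom]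
    rw [Function.comp_apply, Function.comp_apply, hN, map_zero]
  -- The form `𝒟_{m,m-1}` enters here: a set of `m - 1` indices misses some `p`, and `R s` ignores
  -- steps along it.
  · obtain ⟨p, hp⟩ : ∃ p, p ∉ s := by
      by_contra! hall
      have h1 := (Finset.mem_powersetCard.1 hs).2
      rw [Finset.eq_univ_of_forall hall, Finset.card_univ, Fintype.card_fin] at h1
      omega
    refine ⟨_, List.mem_append_left _ (List.mem_map_of_mem (List.mem_finRange p)), ?_⟩
    rintro _ ⟨h, rfl⟩
    ext1 f
    have e : (fun j : s => (f + Pi.single (M := fun _ : Fin m => StrongDual ℝ X) p h) j) =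
        fun j : s => f j := by
      ext1 q
      have hne : (q : Fin m) ≠ p := fun hqp => hp (hqp ▸ q.2)
      rw [Pi.add_apply, Pi.single_eq_of_ne hne, add_zero]
    rw [fwdDiff, e, sub_self, Pi.zero_apply]
  · refine ⟨_, List.mem_append_right _ (List.mem_map_of_mem (a := j) (by simp [hj])), ?_⟩
    exact fun h hh => hh
  · refine approximableBy_charFunDualUnits (hnv i)
      (LinearMap.range (B i ∘ₗ LinearMap.single ℝ _ ⟨0, by omega⟩)) ?_ (hsep _)
    rintro _ ⟨h, rfl⟩
    exact ⟨_, rfl⟩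
  · rcases List.mem_append.1 hS with hS | hS
    · obtain ⟨p, -, rfl⟩ := List.mem_map.1 hS
      refine approximableBy_charFunDualUnits (hnv i) _ ?_ (hsep p)
      rintro _ ⟨h, rfl⟩
      exact ⟨_, ⟨h, rfl⟩, rfl⟩
    · obtain ⟨j, hj, rfl⟩ := List.mem_map.1 hS
      refine approximableBy_charFunDualUnits (hnv i) _ ?_ (hsep' j (by simpa using hj))
      rintro _ ⟨h, hh, rfl⟩
      exact ⟨h, hh, rfl⟩
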